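/- Let $q\ge 1$ and $P_{ij}\in\{0,1\}$ for $1\le i<j\le q$ (the parameters of the $(\mathbb Z_2)^q$ cocycle $\omega_2(g,g')=\exp(-i\pi\sum_{i<j}P_{ij}g_jg'_i)$). Consider a periodic chain of $L$ unit cells with $q$ spins $\tfrac12$ each, let $X^r_i,Z^r_i$ be the Pauli operators of spin $i$ in cell $r\in\mathbb Z/L$, acting on the basis states $|g\rangle$, $g^r_i\in\{0,1\}$, by $Z^r_i|g\rangle=(-1)^{g^r_i}|g\rangle$ and by flipping $g^r_i$, and let $$H_L=-\sum_{r}\sum_{\alpha=1}^q\mathcal O^r_\alpha,\qquad \mathcal O^r_\alpha=\begin{cases}\prod_{1<l\le q}(Z^{r+1}_lZ^r_l)^{P_{1l}}\,X^{r+1}_1&\alpha=1,\\[2pt]\prod_{\alpha<l\le q}(Z^{r+1}_lZ^r_l)^{P_{\alpha l}}\,X^{r+1}_\alpha\prod_{1\le k<\alpha}(Z^{r+2}_kZ^{r+1}_k)^{P_{k\alpha}}&1<\alpha<q,\\[2pt]X^r_q\prod_{1\le k<q}(Z^{r+1}_kZ^r_k)^{P_{kq}}&\alpha=q>1.\end{cases}$$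 (a) Let $T^{g_1\ldots g_q}$ ($g_i\in\{0,1\}$) be $D\times D$ complex matrices, independent of $L$, such that for all sufficiently large $L$ the matrix product state $\sum_{g}\mathrm{Tr}\big(\prod_{r=0}^{L-1}T^{g^r_1\ldots g^r_q}\big)|g\rangle$ is a (nonzero) ground state of $H_L$, and suppose that $D$ is the smallest bond dimension for which such matrices exist. Then every $T^{g_1\ldots g_q}$ that is not the zero matrix has rank exactly $1$. (b) Let $p_\alpha=2$ for $\alpha\in\{1,q\}$ and $p_\alpha=3$ otherwise, and write $\mathcal O^r_\alpha=o^r_{\alpha,1}\cdots o^r_{\alpha,p_\alpha}$, where $o^r_{\alpha,\tau}$ is the part of $\mathcal O^r_\alpha$ acting on cell $r+\tau-1$. For $1\le\tau\le p_\alpha-1$ put $\mathcal L^r_{\alpha,\tau}=o^r_{\alpha,1}\cdots o^r_{\alpha,\tau}$ (on an infinite chain), and let $\mathbf t$ be the matrix over $\mathbb Z/2$, indexed by the pairs $(\alpha,\tau)$, with $\mathcal L^{r-\tau+1}_{\alpha,\tau}\mathcal L^{r-\tau'+1}_{\alpha',\tau'}=(-1)^{\mathbf t_{(\alpha\tau),(\alpha'\tau')}}\mathcal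 L^{r-\tau'+1}_{\alpha',\tau'}\mathcal L^{r-\tau+1}_{\alpha,\tau}$. Let $D=2^{\mathrm{rank}(\mathbf t)/2}$, let $U_{\alpha,\tau}$ be invertible $D\times D$ complex matrices with $U_{\alpha,\tau}U_{\alpha',\tau'}=(-1)^{\mathbf t_{(\alpha\tau),(\alpha'\tau')}}U_{\alpha',\tau'}U_{\alpha,\tau}$, and let the $D\times D$ matrices $T^{g}$, $g=(g_1,\ldots,g_q)$, solve, for all $g$, all $\alpha$ and all $2\le\tau\le p_\alpha-1$, $$o_{\alpha,1}\circ T^g=T^gU_{\alpha,1},\qquad o_{\alpha,\tau}\circ T^g=U_{\alpha,\tau-1}^{-1}T^gU_{\alpha,\tau},\qquad o_{\alpha,p_\alpha}\circ T^g=U_{\alpha,p_\alpha-1}^{-1}T^g,$$ where $\circ$ is the action on the physical indices: $X_i\circ T^g=T^{g_1\ldots(1-g_i)\ldots g_q}$, $Z_i\circ T^g=(-1)^{g_i}T^g$. Then every $T^g$ that is not the zero matrix has rank exactly $1$. -/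

import Mathlib

namespace CocycleMPS

noncomputable section

/-! ### Pauli operators

A configuration of spins on the sites `ι` is `g : ι → ZMod 2`. A state with coefficients
`f g` is the function `f`. With `M = ℂ` these are wave functions; with `M` a space of matrices and
`ι` the spins of one unit cell, the same operators give the action `∘` on MPS matrices. -/

/-- `X_s |g⟩ = |…, 1 - g_s, …⟩`, written on coefficients. -/
def pauliX {ι M : Type*} [DecidableEq ι] [AddCommGroup M] [Module ℂ M] (s : ι) :
    Module.End ℂ ((ι → ZMod 2) → M) where
  toFun f := fun g => f (Function.update g s (1 - g s))
  map_add' _ _ := rfl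
  map_smul' _ _ := rfl

/-- `Z_s |g⟩ = (-1)^{g_s} |g⟩`, written on coefficients. -/
def pauliZ {ι M : Type*} [AddCommGroup M] [Module ℂ M] (s : ι) :
    Module.End ℂ ((ι → ZMod 2) → M) where
  toFun f := fun g => ((-1 : ℂ) ^ (g s).val) • f g
  map_add' f f' := by
    funext g
    simp [smul_add]
  map_smul' c f := by
    funext g
    simp [smul_smul, mul_comm]

/-! ### The cocycle Hamiltonian

A unit cell has `q = n + 1` spins, indexed by `Fin (n + 1)`; the first one is `0` and the last one
is `Fin.last n`. The cells form the ring `C`: `ZMod L` for a periodic chain of `L` cells, `ℤ` for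
the infinite chain. Only the entries `P i j` with `i < j` are ever used. -/

/-- States on the chain of cells `C`. -/
abbrev ChainState (C : Type*) (n : ℕ) : Type _ := (C × Fin (n + 1) → ZMod 2) → ℂ

/-- The stabilizer `O^r_α` of the `(ℤ₂)^q` cocycle model with parameters `P`. -/
def stabilizer {n : ℕ} (P : Fin (n + 1) → Fin (n + 1) → ZMod 2) (C : Type*) [CommRing C]
    [DecidableEq C] (r : C) (α : Fin (n + 1)) : Module.End ℂ (ChainState C n) :=
  if α = 0 then
    ((List.finRange (n + 1)).map fun l =>
      if α < l then (pauliZ (r + 1, l) * pauliZ (r, l)) ^ (P α l).val else 1).prod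
      * pauliX (r + 1, α)
  else if α = Fin.last n then
    pauliX (r, α)
      * ((List.finRange (n + 1)).map fun k =>
        if k < α then (pauliZ (r + 1, k) * pauliZ (r, k)) ^ (P k α).val else 1).prod
  else
    ((List.finRange (n + 1)).map fun l =>
      if α < l then (pauliZ (r + 1, l) * pauliZ (r, l)) ^ (P α l).val else 1).prod
      * pauliX (r + 1, α)
      * ((List.finRange (n + 1)).map fun k =>
        if k < α then (pauliZ (r + 2, k) * pauliZ (r + 1, k)) ^ (P k α).val else 1).prod

/-- The cocycle Hamiltonian `H = - ∑_r ∑_α O^r_α` on `L` unit cells, periodic boundary. -/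
def hamiltonian {n : ℕ} (P : Fin (n + 1) → Fin (n + 1) → ZMod 2) (L : ℕ) [NeZero L] :
    Module.End ℂ (ChainState (ZMod L) n) :=
  - ∑ r : ZMod L, ∑ α : Fin (n + 1), stabilizer P (ZMod L) r α

/-- `ψ` is a (nonzero) eigenvector of `H` for its lowest eigenvalue. -/
def IsGroundState {V : Type*} [AddCommGroup V] [Module ℂ V] (H : Module.End ℂ V) (ψ : V) : Prop :=
  ∃ E : ℝ, H.HasEigenvector (E : ℂ) ψ ∧ ∀ E' : ℝ, H.HasEigenvalue (E' : ℂ) → E ≤ E'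

/-! ### Matrix product states -/

/-- One matrix `T^{g_1 … g_q}` for every configuration of a unit cell; `D` is the bond
dimension. -/
abbrev MPSTensor (n D : ℕ) : Type := (Fin (n + 1) → ZMod 2) → Matrix (Fin D) (Fin D) ℂ

/-- The translation invariant MPS `∑_g Tr(T^{g^0} T^{g^1} ⋯ T^{g^{L-1}}) |g⟩`. -/
def mpsState {n D : ℕ} (T : MPSTensor n D) (L : ℕ) : ChainState (ZMod L) n := fun g =>
  ((List.ofFn fun r : Fin L => T fun i => g (((r : ℕ) : ZMod L), i)).prod).trace

/-- `T`, independent of the system size, describes a ground state of the cocycle Hamiltonian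
for all sufficiently large sizes. -/
def RepresentsGroundState {n D : ℕ} (P : Fin (n + 1) → Fin (n + 1) → ZMod 2)
    (T : MPSTensor n D) : Prop :=
  ∃ L₀ : ℕ, ∀ (L : ℕ) [NeZero L], L₀ ≤ L → IsGroundState (hamiltonian P L) (mpsState T L)

/-- `T` describes the ground state, and does so with the least possible bond dimension. -/
def IsMinimalGroundStateMPS {n D : ℕ} (P : Fin (n + 1) → Fin (n + 1) → ZMod 2)
    (T : MPSTensor n D) : Prop :=
  RepresentsGroundState P T ∧
    ∀ (D' : ℕ) (T' : MPSTensor n D'), RepresentsGroundState P T' → D ≤ D'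

/-! ### The linear equations for the MPS matrices

Every `O^r_α` is an ordered product `o^r_{α,1} o^r_{α,2} ⋯` of operators, the `τ`-th of
which acts on the cell `r + τ - 1` alone. -/

/-- The number of consecutive unit cells on which `O^r_α` acts. -/
def cellRange {n : ℕ} (α : Fin (n + 1)) : ℕ := if α = 0 ∨ α = Fin.last n then 2 else 3

/-- The factor `o_{α,τ}`, written in terms of the Pauli operators `X i`, `Z i` of the
cell on which it acts. -/
def localFactor {n : ℕ} (P : Fin (n + 1) → Fin (n + 1) → ZMod 2) {R : Type*} [Monoid R]
    (X Z : Fin (n + 1) → R) (α : Fin (n + 1)) (τ : ℕ) : R :=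
  let above := ((List.finRange (n + 1)).map fun l =>
    if α < l then Z l ^ (P α l).val else 1).prod
  let below := ((List.finRange (n + 1)).map fun k =>
    if k < α then Z k ^ (P k α).val else 1).prod
  if α = 0 then
    (if τ = 1 then above else if τ = 2 then above * X α else 1)
  else if α = Fin.last n then
    (if τ = 1 then X α * below else if τ = 2 then below else 1)
  else
    (if τ = 1 then above else if τ = 2 then above * X α * below
      else if τ = 3 then below else 1)

/-- `L^r_{α,τ} = o^r_{α,1} ⋯ o^r_{α,τ}` on the infinite chain. -/
def leftPart {n : ℕ} (P : Fin (n + 1) → Fin (n + 1) → ZMod 2) (r : ℤ) (α : Fin (n + 1)) (τ : ℕ) :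
    Module.End ℂ (ChainState ℤ n) :=
  ((List.range τ).map fun μ : ℕ =>
    localFactor P (fun i => pauliX (r + (μ : ℤ), i)) (fun i => pauliZ (r + (μ : ℤ), i)) α (μ + 1)).prod

/-- The pairs `(α, τ)` with `1 ≤ τ ≤ cellRange α - 1`; they label the ways to cut a
stabilizer. -/
abbrev Cut (n : ℕ) : Type := (α : Fin (n + 1)) × Fin (cellRange α - 1)

/-- The position `τ` of the cut, counted from `1`. -/
def Cut.pos {n : ℕ} (c : Cut n) : ℕ := (c.2 : ℕ) + 1

open Classical in
/-- The matrix `t` over `ℤ/2`: the entry is `0` or `1` as the operators `L^{r-τ+1}_{α,τ}` and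
`L^{r-τ'+1}_{α',τ'}`, all cut at the bond to the right of one cell (here `r = 0`), commute or
anticommute. -/
def commutationMatrix {n : ℕ} (P : Fin (n + 1) → Fin (n + 1) → ZMod 2) :
    Matrix (Cut n) (Cut n) (ZMod 2) := fun c d =>
  if Commute (leftPart P (0 - (c.pos : ℤ) + 1) c.1 c.pos) (leftPart P (0 - (d.pos : ℤ) + 1) d.1 d.pos)
    then 0 else 1

/-- The dimension `2^{rank(t)/2}` of the irreducible representation. -/
def irrepDim {n : ℕ} (P : Fin (n + 1) → Fin (n + 1) → ZMod 2) : ℕ :=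
  2 ^ ((commutationMatrix P).rank / 2)

/-- The virtual operators `U_{α,τ}` obey the commutation relations of the `L_{α,τ}`. -/
def IsVirtualAlgebra {n D : ℕ} (P : Fin (n + 1) → Fin (n + 1) → ZMod 2)
    (U : Cut n → GL (Fin D) ℂ) : Prop :=
  ∀ c d : Cut n, (U c : Matrix (Fin D) (Fin D) ℂ) * U d =
    (-1 : ℂ) ^ (commutationMatrix P c d).val • ((U d : Matrix (Fin D) (Fin D) ℂ) * U c)

/-- The action `(o_{α,τ} ∘ T)^g` of a one-cell factor on the physical indices. -/
def localAction {n D : ℕ} (P : Fin (n + 1) → Fin (n + 1) → ZMod 2) (α : Fin (n + 1)) (τ : ℕ)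
    (T : MPSTensor n D) : MPSTensor n D :=
  localFactor P (R := Module.End ℂ (MPSTensor n D)) pauliX pauliZ α τ T

/-- The linear equations for `T`. Here `o_{α,1} = L_{α,1}`, the middle factor
`o_{α,τ} = L_{α,τ-1}⁻¹ L_{α,τ} = R_{α,τ-1} R_{α,τ}⁻¹`, and the last factor is `R_{α,cellRange α - 1}`. -/
structure SolvesLinearEquations {n D : ℕ} (P : Fin (n + 1) → Fin (n + 1) → ZMod 2)
    (U : Cut n → GL (Fin D) ℂ) (T : MPSTensor n D) : Prop where
  first : ∀ c : Cut n, c.pos = 1 → ∀ g,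
    localAction P c.1 1 T g = T g * (U c : Matrix (Fin D) (Fin D) ℂ)
  middle : ∀ c d : Cut n, c.1 = d.1 → c.pos + 1 = d.pos → ∀ g,
    localAction P d.1 d.pos T g =
      ((U c)⁻¹ : GL (Fin D) ℂ).val * T g * (U d : Matrix (Fin D) (Fin D) ℂ)
  last : ∀ c : Cut n, c.pos + 1 = cellRange c.1 → ∀ g,
    localAction P c.1 (cellRange c.1) T g = ((U c)⁻¹ : GL (Fin D) ℂ).val * T g

end

end CocycleMPS

/-! (a) Each stabilizer flips one spin and multiplies by the sign of a linear form; these forms are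
the differences of one quadratic form, `graphForm`. Multiplication by its sign therefore turns the
Hamiltonian into minus the sum of all spin flips, so for every `L` the ground state is unique up to
a scalar: it is `graphState`. Its amplitude is a product over bonds of `W a b = sgn (pairing P b (b
+ a))`. Factoring `W` through its rank `R` gives an MPS by rank one matrices `S g` of bond dimension
`R`, whose words of each length at least 2 span all `R × R` matrices. A minimal tensor `T` has `D ≤
R` and, on long words, the same traces as `S` up to nonzero constants. Nondegeneracy of the trace
form then makes the words of `T` span too (`span_wordProd_eq_top`), and `S g * A * S g = tr(S g * A)
• S g` passes to `T g` up to a constant, which forces rank at most one (`rank_le_one_of_trace_eq`).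

(b) Left parts that flip no spin commute with each other, and so do those that flip one. Hence `t =
B + Bᵀ` with `B` an off-diagonal block, and `rank t ≤ 2 rank B`. The first equations make the rows
of `T g` joint eigenvectors of the `U c` with `c` non-flipping. Products of the other `U d` move
this row space into `2 ^ rank B` different joint eigenspaces, so `2 ^ rank B * rank (T g) ≤ D ≤ 2 ^
rank B` (`two_pow_mul_rank_le`). -/

namespace CocycleMPS

/-! ### Signs and Weyl operators -/

/-- The nontrivial character of `ℤ/2`. -/
noncomputable def sgn (x : ZMod 2) : ℂ := (-1) ^ x.val

@[simp] lemma sgn_zero : sgn 0 = 1 := by simp [sgn]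

lemma sgn_add (x y : ZMod 2) : sgn (x + y) = sgn x * sgn y := by
  have h1 : (1 : ZMod 2).val = 1 := rfl
  have h2 : (1 + 1 : ZMod 2) = 0 := rfl
  have key : ∀ z : ZMod 2, z = 0 ∨ z = 1 := by decide
  rcases key x with rfl | rfl <;> rcases key y with rfl | rfl <;> simp [sgn, h1, h2]

lemma sgn_mul_self (x : ZMod 2) : sgn x * sgn x = 1 := by
  rw [← sgn_add, CharTwo.add_self_eq_zero, sgn_zero]

lemma sgn_ne_zero (x : ZMod 2) : sgn x ≠ 0 := fun h => by
  simpa [h] using sgn_mul_self x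

lemma sgn_injective : Function.Injective sgn := by
  have h1 : (1 : ZMod 2).val = 1 := rfl
  have key : ∀ z : ZMod 2, z = 0 ∨ z = 1 := by decide
  intro x y h
  rcases key x with rfl | rfl <;> rcases key y with rfl | rfl <;>
    first | rfl | (norm_num [sgn, h1] at h)

section Weyl

variable {ι M : Type*} [AddCommGroup M] [Module ℂ M]

/-- The Weyl operator `f ↦ (g ↦ (-1)^{φ g} f (g + s))`. -/
noncomputable def weyl (φ : (ι → ZMod 2) →+ ZMod 2) (s : ι → ZMod 2) :
    Module.End ℂ ((ι → ZMod 2) → M) where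
  toFun f := fun g => sgn (φ g) • f (g + s)
  map_add' f f' := by
    funext g
    simp [smul_add]
  map_smul' c f := by
    funext g
    simp [smul_smul, mul_comm]

lemma weyl_apply (φ : (ι → ZMod 2) →+ ZMod 2) (s : ι → ZMod 2) (f : (ι → ZMod 2) → M)
    (g : ι → ZMod 2) : weyl φ s f g = sgn (φ g) • f (g + s) := rfl

lemma weyl_zero_zero : (weyl 0 0 : Module.End ℂ ((ι → ZMod 2) → M)) = 1 := by
  ext f g
  simp [weyl_apply]

/-- In general the product carries the extra sign `sgn (φ' s)`, which `h` makes trivial. -/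
lemma weyl_mul_weyl (φ φ' : (ι → ZMod 2) →+ ZMod 2) (s s' : ι → ZMod 2) (h : φ' s = 0) :
    (weyl φ s * weyl φ' s' : Module.End ℂ ((ι → ZMod 2) → M)) = weyl (φ + φ') (s + s') := by
  ext f g
  simp [weyl_apply, Module.End.mul_apply, smul_smul, sgn_add, h, add_assoc]

/-- The two orders of multiplication carry the extra signs `sgn (φ' s)` and `sgn (φ s')`. -/
lemma weyl_commute {φ φ' : (ι → ZMod 2) →+ ZMod 2} {s s' : ι → ZMod 2} (h : φ s' = φ' s) :
    Commute (weyl φ s : Module.End ℂ ((ι → ZMod 2) → M)) (weyl φ' s') := by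
  ext f g
  simp only [weyl_apply, Module.End.mul_apply, smul_smul, map_add, sgn_add, h]
  congr 1
  · ring
  · congr 1
    abel

lemma pauliZ_eq_weyl (s : ι) : (pauliZ s : Module.End ℂ ((ι → ZMod 2) → M)) =
    weyl (Pi.evalAddMonoidHom _ s) 0 := by
  ext f g
  simp [weyl_apply, pauliZ, sgn]

lemma pauliX_eq_weyl [DecidableEq ι] (s : ι) : (pauliX s : Module.End ℂ ((ι → ZMod 2) → M)) =
    weyl 0 (Pi.single s 1) := by
  ext f g
  have : Function.update g s (1 - g s) = g + Pi.single s 1 := by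
    funext t
    by_cases h : t = s
    · subst h
      simp [CharTwo.sub_eq_add, add_comm]
    · simp [h]
  simp [weyl_apply, pauliX, this]

lemma weyl_pow_val (φ : (ι → ZMod 2) →+ ZMod 2) (p : ZMod 2) :
    (weyl φ 0 : Module.End ℂ ((ι → ZMod 2) → M)) ^ p.val =
      weyl ((AddMonoidHom.mulLeft p).comp φ) 0 := by
  have key : ∀ z : ZMod 2, z = 0 ∨ z = 1 := by decide
  rcases key p with rfl | rfl
  · rw [ZMod.val_zero, pow_zero, ← weyl_zero_zero]
    congr 1
    ext
    simp
  · have h1 : (1 : ZMod 2).val = 1 := rfl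
    rw [h1, pow_one]
    congr 1
    ext
    simp

lemma list_prod_weyl {κ : Type*} (l : List κ) (φ : κ → (ι → ZMod 2) →+ ZMod 2) :
    (l.map fun i => (weyl (φ i) 0 : Module.End ℂ ((ι → ZMod 2) → M))).prod =
      weyl (l.map φ).sum 0 := by
  induction l with
  | nil => simp [weyl_zero_zero]
  | cons a l ih => simp [ih, weyl_mul_weyl]

end Weyl

/-! ### Linear forms of the products of `Z` operators. -/

section Forms

variable {n : ℕ} (P : Fin (n + 1) → Fin (n + 1) → ZMod 2)

/-- The form `∑_{l > α} P_{αl} x_l`. -/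
def aboveForm (α : Fin (n + 1)) : (Fin (n + 1) → ZMod 2) →+ ZMod 2 :=
  ∑ l, if α < l then (AddMonoidHom.mulLeft (P α l)).comp (Pi.evalAddMonoidHom _ l) else 0

/-- The form `∑_{k < α} P_{kα} x_k`. -/
def belowForm (α : Fin (n + 1)) : (Fin (n + 1) → ZMod 2) →+ ZMod 2 :=
  ∑ k, if k < α then (AddMonoidHom.mulLeft (P k α)).comp (Pi.evalAddMonoidHom _ k) else 0

lemma aboveForm_apply (α : Fin (n + 1)) (x : Fin (n + 1) → ZMod 2) :
    aboveForm P α x = ∑ l, if α < l then P α l * x l else 0 := by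
  rw [aboveForm, AddMonoidHom.finsetSum_apply]
  refine Finset.sum_congr rfl fun l _ => ?_
  split_ifs <;> simp

lemma belowForm_apply (α : Fin (n + 1)) (x : Fin (n + 1) → ZMod 2) :
    belowForm P α x = ∑ k, if k < α then P k α * x k else 0 := by
  rw [belowForm, AddMonoidHom.finsetSum_apply]
  refine Finset.sum_congr rfl fun l _ => ?_
  split_ifs <;> simp

lemma aboveForm_single (α β : Fin (n + 1)) :
    aboveForm P α (Pi.single β 1) = if α < β then P α β else 0 := by
  rw [aboveForm_apply, Finset.sum_eq_single β]
  · simp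
  · intro b _ hb
    simp [hb]
  · simp

lemma belowForm_single (α β : Fin (n + 1)) :
    belowForm P α (Pi.single β 1) = if β < α then P β α else 0 := by
  rw [belowForm_apply, Finset.sum_eq_single β]
  · simp
  · intro b _ hb
    simp [hb]
  · simp

lemma aboveForm_last : aboveForm P (Fin.last n) = 0 := by
  ext x
  simp [aboveForm_apply, not_lt.2 (Fin.le_last _)]

lemma belowForm_zero : belowForm P 0 = 0 := by
  ext x
  simp [belowForm_apply]

variable {ι M : Type*} [AddCommGroup M] [Module ℂ M]

/-- The configuration of the spins labelled by `e`. -/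
def readout {κ : Type*} (e : κ → ι) : (ι → ZMod 2) →+ (κ → ZMod 2) where
  toFun g := fun k => g (e k)
  map_zero' := rfl
  map_add' _ _ := rfl

@[simp] lemma readout_apply {κ : Type*} (e : κ → ι) (g : ι → ZMod 2) (k : κ) :
    readout e g k = g (e k) := rfl

lemma prod_above_eq_weyl (ψ : (ι → ZMod 2) →+ (Fin (n + 1) → ZMod 2)) (α : Fin (n + 1))
    {A : Fin (n + 1) → Module.End ℂ ((ι → ZMod 2) → M)}
    (hA : ∀ l, A l = weyl ((Pi.evalAddMonoidHom _ l).comp ψ) 0) :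
    ((List.finRange (n + 1)).map fun l => if α < l then A l ^ (P α l).val else 1).prod =
      weyl ((aboveForm P α).comp ψ) 0 := by
  rw [show (fun l => if α < l then A l ^ (P α l).val else 1) =
      fun l => weyl (if α < l then (AddMonoidHom.mulLeft (P α l)).comp
        ((Pi.evalAddMonoidHom _ l).comp ψ) else 0) 0 from ?_, list_prod_weyl]
  · congr 1
    ext g
    rw [← List.ofFn_eq_map, List.sum_ofFn, AddMonoidHom.finsetSum_apply, AddMonoidHom.comp_apply,
      aboveForm_apply]
    refine Finset.sum_congr rfl fun l _ => ?_
    split_ifs <;> simp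
  · funext l
    split_ifs
    · rw [hA, weyl_pow_val]
    · rw [weyl_zero_zero]

lemma prod_below_eq_weyl (ψ : (ι → ZMod 2) →+ (Fin (n + 1) → ZMod 2)) (α : Fin (n + 1))
    {A : Fin (n + 1) → Module.End ℂ ((ι → ZMod 2) → M)}
    (hA : ∀ l, A l = weyl ((Pi.evalAddMonoidHom _ l).comp ψ) 0) :
    ((List.finRange (n + 1)).map fun l => if l < α then A l ^ (P l α).val else 1).prod =
      weyl ((belowForm P α).comp ψ) 0 := by
  rw [show (fun l => if l < α then A l ^ (P l α).val else 1) =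
      fun l => weyl (if l < α then (AddMonoidHom.mulLeft (P l α)).comp
        ((Pi.evalAddMonoidHom _ l).comp ψ) else 0) 0 from ?_, list_prod_weyl]
  · congr 1
    ext g
    rw [← List.ofFn_eq_map, List.sum_ofFn, AddMonoidHom.finsetSum_apply, AddMonoidHom.comp_apply,
      belowForm_apply]
    refine Finset.sum_congr rfl fun l _ => ?_
    split_ifs <;> simp
  · funext l
    split_ifs
    · rw [hA, weyl_pow_val]
    · rw [weyl_zero_zero]

lemma pauliZ_eq_weyl_readout {κ : Type*} (e : κ → ι) (l : κ) :
    (pauliZ (e l) : Module.End ℂ ((ι → ZMod 2) → M)) =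
      weyl ((Pi.evalAddMonoidHom _ l).comp (readout e)) 0 :=
  pauliZ_eq_weyl _

lemma pauliZ_mul_eq_weyl_readout {κ : Type*} (e e' : κ → ι) (l : κ) :
    (pauliZ (e l) * pauliZ (e' l) : Module.End ℂ ((ι → ZMod 2) → M)) =
      weyl ((Pi.evalAddMonoidHom _ l).comp (readout e + readout e')) 0 := by
  rw [pauliZ_eq_weyl, pauliZ_eq_weyl, weyl_mul_weyl _ _ _ _ (map_zero _), add_zero]
  rfl

end Forms

/-! ### The ground state of the cocycle Hamiltonian -/

section GroundState

variable {n : ℕ} (P : Fin (n + 1) → Fin (n + 1) → ZMod 2)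

/-- The configuration of the unit cell `c`. -/
abbrev cell {C : Type*} {n : ℕ} (c : C) :
    (C × Fin (n + 1) → ZMod 2) →+ (Fin (n + 1) → ZMod 2) :=
  readout (Prod.mk c)

lemma cell_single {C : Type*} [DecidableEq C] (c s : C) (α : Fin (n + 1)) :
    cell c (Pi.single (s, α) 1 : C × Fin (n + 1) → ZMod 2) =
      if c = s then Pi.single α 1 else 0 := by
  funext i
  by_cases h : c = s
  · subst h
    by_cases hi : i = α
    · subst hi
      simp
    · simp [hi]
  · simp [h]

lemma belowForm_cell_single {C : Type*} [DecidableEq C] (c s : C) (α : Fin (n + 1)) :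
    belowForm P α (cell c (Pi.single (s, α) 1 : C × Fin (n + 1) → ZMod 2)) = 0 := by
  rw [cell_single]
  split_ifs <;> simp [belowForm_single]

/-! ### Stabilizers as Weyl operators and the quadratic form behind their signs. -/

section Stabilizer

variable {C : Type*} [CommRing C] [DecidableEq C]

/-- The cell whose spin `α` is flipped by `O^r_α`. -/
def flippedCell (r : C) (α : Fin (n + 1)) : C :=
  if α ≠ 0 ∧ α = Fin.last n then r else r + 1

/-- The form giving the sign of the stabilizer which flips spin `α` of cell `s`. -/
def stabilizerForm (s : C) (α : Fin (n + 1)) : (C × Fin (n + 1) → ZMod 2) →+ ZMod 2 :=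
  (aboveForm P α).comp (cell s + cell (s - 1)) + (belowForm P α).comp (cell (s + 1) + cell s)

/-- The three cases merge into one formula because `belowForm P 0` and `aboveForm P (Fin.last n)`
vanish. Labelling by the flipped cell absorbs the different offsets. -/
lemma stabilizer_eq_weyl (r : C) (α : Fin (n + 1)) :
    stabilizer P C r α =
      weyl (stabilizerForm P (flippedCell r α) α) (Pi.single (flippedCell r α, α) 1) := by
  have above : ∀ c d : C, ((List.finRange (n + 1)).map fun l => if α < l then
      (pauliZ (c, l) * pauliZ (d, l) : Module.End ℂ (ChainState C n)) ^ (P α l).val else 1).prod =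
      weyl ((aboveForm P α).comp (cell c + cell d)) 0 := fun c d =>
    prod_above_eq_weyl P _ _ fun l => pauliZ_mul_eq_weyl_readout (Prod.mk c) (Prod.mk d) l
  have below : ∀ c d : C, ((List.finRange (n + 1)).map fun l => if l < α then
      (pauliZ (c, l) * pauliZ (d, l) : Module.End ℂ (ChainState C n)) ^ (P l α).val else 1).prod =
      weyl ((belowForm P α).comp (cell c + cell d)) 0 := fun c d =>
    prod_below_eq_weyl P _ _ fun l => pauliZ_mul_eq_weyl_readout (Prod.mk c) (Prod.mk d) l
  have hb : ∀ c d s : C, (belowForm P α).comp (cell c + cell d)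
      (Pi.single (s, α) 1 : C × Fin (n + 1) → ZMod 2) = 0 := fun c d s => by
    simp [belowForm_cell_single]
  rw [stabilizer]
  split_ifs with h0 h1
  · have hs : flippedCell r α = r + 1 := by simp [flippedCell, h0]
    rw [above, pauliX_eq_weyl, weyl_mul_weyl _ _ _ _ rfl, hs, zero_add, stabilizerForm,
      add_sub_cancel_right]
    congr 2
    rw [h0, belowForm_zero]
    rfl
  · have hs : flippedCell r α = r := by simp [flippedCell, h0, ← h1]
    rw [below, pauliX_eq_weyl, weyl_mul_weyl _ _ _ _ (hb _ _ _), hs, add_zero, stabilizerForm]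
    congr 2
    rw [h1, aboveForm_last]
    rfl
  · have hs : flippedCell r α = r + 1 := by simp [flippedCell, h1]
    rw [above, below, pauliX_eq_weyl, weyl_mul_weyl _ _ _ _ rfl, zero_add,
      weyl_mul_weyl _ _ _ _ (hb _ _ _), hs, add_zero, add_zero, stabilizerForm,
      add_sub_cancel_right, add_assoc r 1 1, one_add_one_eq_two]

/-- The form `∑_{k < l} P_{kl} b_k a_l`. -/
def pairing (b a : Fin (n + 1) → ZMod 2) : ZMod 2 := ∑ k, b k * aboveForm P k a

lemma pairing_add_left (b b' a : Fin (n + 1) → ZMod 2) :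
    pairing P (b + b') a = pairing P b a + pairing P b' a := by
  simp [pairing, add_mul, Finset.sum_add_distrib]

lemma pairing_add_right (b a a' : Fin (n + 1) → ZMod 2) :
    pairing P b (a + a') = pairing P b a + pairing P b a' := by
  simp [pairing, mul_add, Finset.sum_add_distrib]

lemma pairing_zero_left (a : Fin (n + 1) → ZMod 2) : pairing P 0 a = 0 := by
  simp [pairing]

lemma pairing_zero_right (a : Fin (n + 1) → ZMod 2) : pairing P a 0 = 0 := by
  simp [pairing]

lemma pairing_single_left (α : Fin (n + 1)) (a : Fin (n + 1) → ZMod 2) :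
    pairing P (Pi.single α 1) a = aboveForm P α a := by
  rw [pairing, Finset.sum_eq_single α]
  · simp
  · intro b _ hb
    simp [hb]
  · simp

lemma pairing_single_right (α : Fin (n + 1)) (b : Fin (n + 1) → ZMod 2) :
    pairing P b (Pi.single α 1) = belowForm P α b := by
  rw [pairing, belowForm_apply]
  refine Finset.sum_congr rfl fun k _ => ?_
  rw [aboveForm_single]
  split_ifs <;> simp [mul_comm]

variable [Fintype C]

/-- The exponent of the sign of `|g⟩` in the graph state stabilized by all `O^r_α`. -/
def graphForm (g : C × Fin (n + 1) → ZMod 2) : ZMod 2 :=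
  ∑ r : C, pairing P (cell r g) (cell r g + cell (r - 1) g)

lemma graphForm_add_single (s : C) (α : Fin (n + 1)) (g : C × Fin (n + 1) → ZMod 2) :
    graphForm P (g + Pi.single (s, α) 1) = graphForm P g + stabilizerForm P s α g := by
  set d : C → Fin (n + 1) → ZMod 2 := fun c => if c = s then Pi.single α 1 else 0 with hd
  -- The pairing only couples `k < l`, so flipping a single spin produces no second order term.
  have hdd : ∀ c c', pairing P (d c) (d c') = 0 := fun c c' => by
    simp only [hd]
    split_ifs <;>
      simp [pairing_single_left, aboveForm_single, pairing_zero_left, pairing_zero_right]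
  have hl : ∀ c a, pairing P (d c) a = if c = s then aboveForm P α a else 0 := fun c a => by
    simp only [hd]
    split_ifs <;> simp [pairing_single_left, pairing_zero_left]
  have hr : ∀ c b, pairing P b (d c) = if c = s then belowForm P α b else 0 := fun c a => by
    simp only [hd]
    split_ifs <;> simp [pairing_single_right, pairing_zero_right]
  have hterm : ∀ r : C, pairing P (cell r (g + Pi.single (s, α) 1))
      (cell r (g + Pi.single (s, α) 1) + cell (r - 1) (g + Pi.single (s, α) 1)) =
      pairing P (cell r g) (cell r g + cell (r - 1) g)
        + ((if r = s then belowForm P α (cell r g) else 0)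
          + (if r = s + 1 then belowForm P α (cell r g) else 0)
          + (if r = s then aboveForm P α (cell r g + cell (r - 1) g) else 0)) := fun r => by
    rw [map_add, map_add, cell_single, cell_single]
    change pairing P (cell r g + d r) (cell r g + d r + (cell (r - 1) g + d (r - 1))) = _
    simp only [pairing_add_left, pairing_add_right, hdd]
    simp only [hl, hr, sub_eq_iff_eq_add, map_add]
    split_ifs <;> simp <;> abel
  rw [graphForm, Finset.sum_congr rfl fun r _ => hterm r, Finset.sum_add_distrib,
    Finset.sum_add_distrib, Finset.sum_add_distrib]
  simp only [Finset.sum_ite_eq', Finset.mem_univ, if_true]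
  rw [graphForm, stabilizerForm]
  simp
  abel

end Stabilizer

/-- A function on a finite set whose average over permutations `σ i` is at least as large a multiple
of itself as possible is invariant under all of them. -/
lemma invariant_of_card_le_eigenvalue {G I : Type*} [Fintype G] [Fintype I] (σ : I → Equiv.Perm G)
    (f : G → ℂ) (μ : ℝ) (hμ : (Fintype.card I : ℝ) ≤ μ)
    (hf : ∀ g, ∑ i, f (σ i g) = μ * f g) (i : I) (g : G) : f (σ i g) = f g := by
  -- Summed over `i`, this gives `2 (card I - μ) ‖f‖²`, which is at most zero, so every square
  -- vanishes.
  have hsq : ∀ i, ∑ g, ‖f (σ i g) - f g‖ ^ 2 =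
      2 * ∑ g, ‖f g‖ ^ 2 - 2 * ∑ g, (f (σ i g) * (starRingEnd ℂ) (f g)).re := fun i => by
    have h1 : ∑ g, ‖f (σ i g)‖ ^ 2 = ∑ g, ‖f g‖ ^ 2 :=
      Equiv.sum_comp (σ i) fun g => ‖f g‖ ^ 2
    rw [two_mul]
    nth_rewrite 1 [← h1]
    rw [Finset.mul_sum, ← Finset.sum_add_distrib, ← Finset.sum_sub_distrib]
    refine Finset.sum_congr rfl fun g _ => ?_
    simp only [← Complex.normSq_eq_norm_sq, Complex.normSq_sub]
  have htot : ∑ i, ∑ g, (f (σ i g) * (starRingEnd ℂ) (f g)).re = μ * ∑ g, ‖f g‖ ^ 2 := by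
    rw [Finset.sum_comm, Finset.mul_sum]
    refine Finset.sum_congr rfl fun g _ => ?_
    rw [← Complex.re_sum, ← Finset.sum_mul, hf, mul_assoc, Complex.mul_conj,
      Complex.normSq_eq_norm_sq, ← Complex.ofReal_mul, Complex.ofReal_re]
  have hle : ∑ i, ∑ g, ‖f (σ i g) - f g‖ ^ 2 ≤ 0 := by
    rw [Finset.sum_congr rfl fun i _ => hsq i, Finset.sum_sub_distrib, ← Finset.mul_sum,
      ← Finset.mul_sum, htot]
    have : (0 : ℝ) ≤ ∑ g, ‖f g‖ ^ 2 := by positivity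
    simp only [Finset.sum_const, Finset.card_univ, nsmul_eq_mul]
    nlinarith
  have hzero := (Finset.sum_eq_zero_iff_of_nonneg fun i _ => by positivity).1
    (le_antisymm hle (by positivity)) i (Finset.mem_univ i)
  have := (Finset.sum_eq_zero_iff_of_nonneg fun g _ => by positivity).1 hzero g
    (Finset.mem_univ g)
  simpa [sub_eq_zero] using this

/-- A function on configurations which no spin flip changes is constant. -/
lemma eq_apply_zero_of_flip_invariant {ι M : Type*} [Fintype ι] [DecidableEq ι]
    (f : (ι → ZMod 2) → M) (hf : ∀ i g, f (g + Pi.single i 1) = f g) (g : ι → ZMod 2) :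
    f g = f 0 := by
  have key : ∀ z : ZMod 2, z = 0 ∨ z = 1 := by decide
  have h : ∀ s : Finset ι, f (∑ i ∈ s, Pi.single i (g i)) = f 0 := fun s => by
    induction s using Finset.induction_on with
    | empty => simp
    | insert a s ha ih =>
      rw [Finset.sum_insert ha, add_comm]
      rcases key (g a) with h | h
      · rw [h, Pi.single_zero, add_zero, ih]
      · rw [h, hf, ih]
  simpa [Finset.univ_sum_single] using h Finset.univ

/-! ### Uniqueness of the ground state. -/

variable (L : ℕ) [NeZero L]

/-- The graph state, which is the ground state of the cocycle Hamiltonian. -/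
noncomputable def graphState : ChainState (ZMod L) n := fun g => sgn (graphForm P g)

/-- By `graphForm_add_single` a flip changes the graph state by exactly the sign in the stabilizer;
the two signs cancel and only bare spin flips remain. -/
lemma hamiltonian_graphState_mul (f : ChainState (ZMod L) n) (g : ZMod L × Fin (n + 1) → ZMod 2) :
    hamiltonian P L (graphState P L * f) g =
      - (graphState P L g * ∑ x : ZMod L × Fin (n + 1),
          f (g + Pi.single (flippedCell x.1 x.2, x.2) 1)) := by
  rw [hamiltonian, LinearMap.neg_apply, Pi.neg_apply, LinearMap.sum_apply, Finset.sum_apply,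
    Fintype.sum_prod_type, Finset.mul_sum]
  congr 1
  refine Finset.sum_congr rfl fun r _ => ?_
  rw [LinearMap.sum_apply, Finset.sum_apply, Finset.mul_sum]
  refine Finset.sum_congr rfl fun α _ => ?_
  rw [stabilizer_eq_weyl, weyl_apply, Pi.mul_apply, graphState, graphForm_add_single, sgn_add,
    smul_eq_mul, mul_comm (sgn (graphForm P g)), mul_assoc, ← mul_assoc, sgn_mul_self, one_mul]
  rfl

lemma eigenvector_graphState_mul_iff (f : ChainState (ZMod L) n) (E : ℝ) :
    hamiltonian P L (graphState P L * f) = (E : ℂ) • (graphState P L * f) ↔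
      ∀ g, ∑ x : ZMod L × Fin (n + 1), f (g + Pi.single (flippedCell x.1 x.2, x.2) 1) =
        ((-E : ℝ) : ℂ) * f g := by
  rw [funext_iff]
  refine forall_congr' fun g => ?_
  rw [hamiltonian_graphState_mul, Pi.smul_apply, Pi.mul_apply, smul_eq_mul]
  have h : graphState P L g ≠ 0 := sgn_ne_zero _
  constructor
  · intro H
    apply mul_left_cancel₀ h
    push_cast
    linear_combination -H
  · intro H
    rw [H]
    push_cast
    ring

lemma graphState_mul_self_mul (ψ : ChainState (ZMod L) n) :
    graphState P L * (graphState P L * ψ) = ψ := by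
  funext g
  simp [graphState, ← mul_assoc, sgn_mul_self]

/-- Allowing all `E` up to the graph state energy, rather than equality, yields both minimality and
uniqueness. -/
lemma exists_smul_graphState {ψ : ChainState (ZMod L) n} {E : ℝ}
    (h : hamiltonian P L ψ = (E : ℂ) • ψ)
    (hE : E ≤ -(Fintype.card (ZMod L × Fin (n + 1)) : ℝ)) : ∃ c : ℂ, ψ = c • graphState P L := by
  set f := graphState P L * ψ with hf
  rw [← graphState_mul_self_mul P L ψ, ← hf, eigenvector_graphState_mul_iff] at h
  have hinv := invariant_of_card_le_eigenvalue
    (fun x : ZMod L × Fin (n + 1) => Equiv.addRight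
      (Pi.single (flippedCell x.1 x.2, x.2) 1 : ZMod L × Fin (n + 1) → ZMod 2)) f (-E)
    (by linarith) h
  -- Every spin is flipped by some stabilizer, as `flippedCell · α` is surjective.
  have hconst := eq_apply_zero_of_flip_invariant f fun ⟨s, α⟩ g => by
    obtain ⟨r, hr⟩ : ∃ r : ZMod L, flippedCell r α = s := by
      unfold flippedCell
      split_ifs
      · exact ⟨s, rfl⟩
      · exact ⟨s - 1, by ring⟩
    have := hinv (r, α) g
    simpa [hr] using this
  refine ⟨f 0, ?_⟩
  rw [← graphState_mul_self_mul P L ψ, ← hf]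
  funext g
  simp [hconst g, mul_comm]

lemma graphState_ne_zero : graphState P L ≠ 0 := fun h =>
  sgn_ne_zero _ (congrFun h 0)

lemma hamiltonian_graphState : hamiltonian P L (graphState P L) =
    ((-(Fintype.card (ZMod L × Fin (n + 1)) : ℝ) : ℝ) : ℂ) • graphState P L := by
  have := (eigenvector_graphState_mul_iff P L 1
    (-(Fintype.card (ZMod L × Fin (n + 1)) : ℝ))).2 fun g => by simp
  rwa [mul_one] at this

lemma isGroundState_graphState : IsGroundState (hamiltonian P L) (graphState P L) := by
  refine ⟨-(Fintype.card (ZMod L × Fin (n + 1)) : ℝ), ?_, fun E' hE' => ?_⟩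
  · exact Module.End.hasEigenvector_iff.2 ⟨Module.End.mem_eigenspace_iff.2
      (hamiltonian_graphState P L), graphState_ne_zero P L⟩
  · by_contra! hlt
    obtain ⟨ψ, hψ⟩ := hE'.exists_hasEigenvector
    obtain ⟨c, rfl⟩ := exists_smul_graphState P L hψ.apply_eq_smul hlt.le
    have h1 := hψ.apply_eq_smul
    rw [map_smul, hamiltonian_graphState, smul_comm] at h1
    have := smul_left_injective ℂ hψ.2 h1
    exact hlt.ne (Complex.ofReal_injective this).symm

lemma IsGroundState.exists_eq_smul {ψ : ChainState (ZMod L) n}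
    (h : IsGroundState (hamiltonian P L) ψ) : ∃ c : ℂ, c ≠ 0 ∧ ψ = c • graphState P L := by
  obtain ⟨E, hE, hmin⟩ := h
  have hle := hmin (-(Fintype.card (ZMod L × Fin (n + 1)) : ℝ))
    (Module.End.hasEigenvalue_of_hasEigenvector (Module.End.hasEigenvector_iff.2
      ⟨Module.End.mem_eigenspace_iff.2 (hamiltonian_graphState P L), graphState_ne_zero P L⟩))
  obtain ⟨c, hc⟩ := exists_smul_graphState P L hE.apply_eq_smul hle
  refine ⟨c, ?_, hc⟩
  rintro rfl
  exact hE.2 (by simpa using hc)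

end GroundState

/-! ### Matrix product states of minimal bond dimension -/

section Minimal

open Matrix

/-- `W` factors through its range. The one-sided inverses say that the rows of `Y` and the columns
of `X` span, which is what generating the matrix algebra requires. -/
lemma exists_rank_factorization {K m n : Type*} [Field K] [Fintype m] [DecidableEq m] [Fintype n]
    [DecidableEq n] (W : Matrix m n K) :
    ∃ (Y : Matrix m (Fin W.rank) K) (X : Matrix (Fin W.rank) n K),
      Y * X = W ∧ (∃ Y' : Matrix (Fin W.rank) m K, Y' * Y = 1) ∧
        ∃ X' : Matrix n (Fin W.rank) K, X * X' = 1 := by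
  let e : LinearMap.range W.mulVecLin ≃ₗ[K] (Fin W.rank → K) :=
    LinearEquiv.ofFinrankEq _ _ (Module.finrank_fin_fun K).symm
  let y : (Fin W.rank → K) →ₗ[K] (m → K) := (LinearMap.range W.mulVecLin).subtype ∘ₗ e.symm
  let x : (n → K) →ₗ[K] (Fin W.rank → K) := e.toLinearMap ∘ₗ W.mulVecLin.rangeRestrict
  obtain ⟨y', hy'⟩ := y.exists_leftInverse_of_injective (LinearMap.ker_eq_bot.2
    ((Submodule.subtype_injective _).comp e.symm.injective))
  obtain ⟨x', hx'⟩ := x.exists_rightInverse_of_surjective (LinearMap.range_eq_top.2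
    (e.surjective.comp W.mulVecLin.surjective_rangeRestrict))
  refine ⟨y.toMatrix', x.toMatrix', ?_, ⟨y'.toMatrix', ?_⟩, ⟨x'.toMatrix', ?_⟩⟩
  · rw [← LinearMap.toMatrix'_comp]
    convert LinearMap.toMatrix'_toLin' W
    ext
    simp [x, y]
  · rw [← LinearMap.toMatrix'_comp, hy', LinearMap.toMatrix'_id]
  · rw [← LinearMap.toMatrix'_comp, hx', LinearMap.toMatrix'_id]

/-- The product of the matrices of a tensor along a word. -/
def wordProd {κ R : Type*} [Monoid R] (T : κ → R) (u : List κ) : R := (u.map T).prod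

lemma wordProd_append {κ R : Type*} [Monoid R] (T : κ → R) (u v : List κ) :
    wordProd T (u ++ v) = wordProd T u * wordProd T v := by
  simp [wordProd]

lemma wordProd_cons {κ R : Type*} [Monoid R] (T : κ → R) (a : κ) (v : List κ) :
    wordProd T (a :: v) = T a * wordProd T v := by
  simp [wordProd]

lemma vecMulVec_mul_mul_vecMulVec {D : ℕ} (x y x' y' : Fin D → ℂ) (A : Matrix (Fin D) (Fin D) ℂ) :
    vecMulVec x y * A * vecMulVec x' y' = (y ⬝ᵥ (A *ᵥ x')) • vecMulVec x y' := by
  rw [vecMulVec_mul, vecMulVec_mul_vecMulVec, dotProduct_mulVec]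
  ext i j
  simp [vecMulVec_apply]
  ring

/-- A matrix satisfying `T A T = κ tr(T A) T` for all `A` has rank at most one. -/
lemma rank_le_one_of_sandwich {D : ℕ} {M : Matrix (Fin D) (Fin D) ℂ} {κ : ℂ}
    (h : ∀ A, M * A * M = (κ * (M * A).trace) • M) : M.rank ≤ 1 := by
  by_cases h0 : M = 0
  · simp [h0]
  obtain ⟨i, j, hij⟩ : ∃ i j, M i j ≠ 0 := by
    by_contra! H
    exact h0 (by ext i j; simp [H])
  -- For the matrix unit `A = E_{ji}`, `M * A * M` is an outer product with `(i, j)` entry `(M i j)²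
  -- ≠ 0`, so `M` is a multiple of an outer product.
  have h1 := h (vecMulVec (Pi.single j 1) (Pi.single i 1))
  rw [mul_vecMulVec, vecMulVec_mul] at h1
  have hc : κ * (vecMulVec (M *ᵥ Pi.single j 1) (Pi.single i 1)).trace ≠ 0 := fun hc => by
    rw [hc, zero_smul] at h1
    have := congrFun (congrFun h1 i) j
    simp [vecMulVec_apply, hij] at this
  rw [← inv_smul_eq_iff₀ hc] at h1
  rw [← h1, ← smul_vecMulVec]
  exact rank_vecMulVec_le _ _

lemma rank_eq_one_of_le_one {D : ℕ} {M : Matrix (Fin D) (Fin D) ℂ} (h : M.rank ≤ 1)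
    (h0 : M ≠ 0) : M.rank = 1 := by
  have : M.rank ≠ 0 := fun H => h0 (by
    rw [Matrix.rank, Submodule.finrank_eq_zero, LinearMap.range_eq_bot] at H
    ext i j
    simpa using congrFun (LinearMap.congr_fun H (Pi.single j 1)) i)
  omega

variable {κ : Type*}

/-- Two tensors with proportional matrix product states, the first of which has a bond dimension
that is not larger: if the words of the second span the matrix algebra, so do those of the
first. -/
lemma span_wordProd_eq_top {D R N : ℕ} (hDR : D ≤ R) {T : κ → Matrix (Fin D) (Fin D) ℂ}
    {S : κ → Matrix (Fin R) (Fin R) ℂ} {c : ℂ} (hc : c ≠ 0)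
    (htr : ∀ u : List κ, u.length = N + N →
      (wordProd T u).trace = c * (wordProd S u).trace)
    (hS : Submodule.span ℂ (Set.range fun u : {u : List κ // u.length = N} =>
      wordProd S u.1) = ⊤) :
    Submodule.span ℂ (Set.range fun u : {u : List κ // u.length = N} => wordProd T u.1) = ⊤ := by
  set t := fun u : {u : List κ // u.length = N} => wordProd T u.1
  set s := fun u : {u : List κ // u.length = N} => wordProd S u.1
  have hts : ∀ u v, (t u * t v).trace = c * (s u * s v).trace := fun u v => by
    simp only [t, s, ← wordProd_append]
    exact htr _ (by simp [u.2, v.2])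
  -- A relation among the `t u` makes the same combination of the `s u` trace-orthogonal to all `s
  -- v`. These span, so that combination is zero. Hence the span of `t` has dimension at least `R² ≥
  -- D²`.
  have hker : LinearMap.ker (Finsupp.linearCombination ℂ t) ≤
      LinearMap.ker (Finsupp.linearCombination ℂ s) := by
    intro a ha
    rw [LinearMap.mem_ker] at ha ⊢
    have h1 : ∀ v, (Finsupp.linearCombination ℂ s a * s v).trace = 0 := fun v => by
      apply (mul_eq_zero.1 _).resolve_left hc
      have h2 : (Finsupp.linearCombination ℂ t a * t v).trace = 0 := by simp [ha]
      rw [← h2, Finsupp.linearCombination_apply, Finsupp.linearCombination_apply, Finsupp.sum,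
        Finsupp.sum, Finset.sum_mul, Finset.sum_mul, trace_sum, trace_sum, Finset.mul_sum]
      refine Finset.sum_congr rfl fun u _ => ?_
      rw [smul_mul_assoc, smul_mul_assoc, trace_smul, trace_smul, hts, smul_eq_mul, smul_eq_mul]
      ring
    refine Matrix.ext_iff_trace_mul_right.2 fun B => ?_
    have hB : B ∈ Submodule.span ℂ (Set.range s) := hS ▸ Submodule.mem_top
    induction hB using Submodule.span_induction with
    | mem x hx =>
      obtain ⟨v, rfl⟩ := hx
      simp [h1]
    | zero => simp
    | add x y _ _ hx hy => simp_all [mul_add]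
    | smul a x _ hx => simp_all
  rw [← Finsupp.range_linearCombination] at hS ⊢
  have hle : Module.finrank ℂ (LinearMap.range (Finsupp.linearCombination ℂ s)) ≤
      Module.finrank ℂ (LinearMap.range (Finsupp.linearCombination ℂ t)) := by
    let e := (LinearMap.quotKerEquivRange (Finsupp.linearCombination ℂ t))
    let p := ((LinearMap.ker (Finsupp.linearCombination ℂ t)).liftQ
      (Finsupp.linearCombination ℂ s) hker) ∘ₗ e.symm.toLinearMap
    have hp : LinearMap.range p = LinearMap.range (Finsupp.linearCombination ℂ s) := by
      rw [LinearMap.range_comp, LinearEquiv.range, Submodule.map_top, Submodule.range_liftQ]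
    rw [← hp]
    exact LinearMap.finrank_range_le p
  apply Submodule.eq_top_of_finrank_eq
  refine le_antisymm (Submodule.finrank_le _) (le_trans ?_ hle)
  rw [hS, finrank_top, Module.finrank_matrix, Module.finrank_matrix]
  simpa using Nat.mul_le_mul hDR hDR

/-- The sandwich identity for `S g`, tested against words, is an identity between traces of words.
It transfers to `T`, whose words span, and extends bilinearly. -/
lemma rank_le_one_of_trace_eq {D R L₀ : ℕ} (hDR : D ≤ R) {T : κ → Matrix (Fin D) (Fin D) ℂ}
    {S : κ → Matrix (Fin R) (Fin R) ℂ} {c : ℕ → ℂ} (hc : ∀ L, L₀ ≤ L → c L ≠ 0)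
    (htr : ∀ u : List κ, L₀ ≤ u.length →
      (wordProd T u).trace = c u.length * (wordProd S u).trace)
    (hspan : ∀ N, 2 ≤ N → Submodule.span ℂ (Set.range fun u : {u : List κ // u.length = N} =>
      wordProd S u.1) = ⊤)
    (hS : ∀ g A, S g * A * S g = (S g * A).trace • S g) (g : κ) : (T g).rank ≤ 1 := by
  set N := L₀ + 2
  have htop := span_wordProd_eq_top (N := N) hDR (hc (N + N) (by omega))
    (fun u hu => by rw [htr u (by omega), hu]) (hspan N (by omega))
  -- The left trace has length `2N + 2`, the two on the right length `N + 1`; this fixes the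
  -- constant.
  have hword : ∀ u v : List κ, u.length = N → v.length = N →
      (T g * wordProd T u * T g * wordProd T v).trace =
        (c (N + N + 2) / (c (N + 1) * c (N + 1)) * (T g * wordProd T u).trace) *
          (T g * wordProd T v).trace := fun u v hu hv => by
    have h1 : ∀ w : List κ, w.length = N →
        (T g * wordProd T w).trace = c (N + 1) * (S g * wordProd S w).trace := fun w hw => by
      rw [← wordProd_cons, ← wordProd_cons, htr _ (by simp [hw, N]; omega)]
      simp [hw]
    have h2 : (T g * wordProd T u * T g * wordProd T v).trace =
        c (N + N + 2) * (S g * wordProd S u * S g * wordProd S v).trace := by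
      have := htr ((g :: u) ++ (g :: v)) (by simp [hu, hv, N]; omega)
      rw [wordProd_append, wordProd_append, wordProd_cons, wordProd_cons, wordProd_cons,
        wordProd_cons, ← mul_assoc, ← mul_assoc] at this
      rw [this]
      congr 2
      simp [hu, hv]
      omega
    rw [h2, h1 u hu, h1 v hv, hS, smul_mul_assoc, trace_smul, smul_eq_mul]
    have := hc (N + 1) (by omega)
    field_simp
  refine rank_le_one_of_sandwich (κ := c (N + N + 2) / (c (N + 1) * c (N + 1))) fun A => ?_
  refine Matrix.ext_iff_trace_mul_right.2 fun B => ?_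
  have hA : A ∈ Submodule.span ℂ (Set.range fun u : {u : List κ // u.length = N} =>
    wordProd T u.1) := htop ▸ Submodule.mem_top
  have hB : B ∈ Submodule.span ℂ (Set.range fun u : {u : List κ // u.length = N} =>
    wordProd T u.1) := htop ▸ Submodule.mem_top
  induction hA, hB using Submodule.span_induction₂ with
  | mem_mem x y hx hy =>
    obtain ⟨u, rfl⟩ := hx
    obtain ⟨v, rfl⟩ := hy
    rw [smul_mul_assoc, trace_smul, smul_eq_mul]
    exact hword u.1 v.1 u.2 v.2
  | zero_left y _ => simp
  | zero_right x _ => simp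
  | add_left x y z _ _ _ hx hy =>
    simp only [mul_add, add_mul, trace_add, hx, hy, add_smul]
  | add_right x y z _ _ _ hx hy =>
    simp only [mul_add, trace_add, hx, hy]
  | smul_left r x y _ _ hx =>
    simp only [mul_smul_comm, smul_mul_assoc, trace_smul, smul_eq_mul] at hx ⊢
    rw [hx]
    ring
  | smul_right r x y _ _ hx =>
    simp only [mul_smul_comm, trace_smul, hx]

/-! ### Words in rank one matrices. -/

section RankOne

variable {R : ℕ} (x y : κ → Fin R → ℂ)

lemma dotProduct_wordProd_vecMulVec_ne_zero (hxy : ∀ a b, y a ⬝ᵥ x b ≠ 0) (u : List κ)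
    (a b : κ) : y a ⬝ᵥ (wordProd (fun g => vecMulVec (x g) (y g)) u *ᵥ x b) ≠ 0 := by
  induction u generalizing a with
  | nil => simpa [wordProd] using hxy a b
  | cons d u ih =>
    rw [wordProd_cons, ← mulVec_mulVec, vecMulVec_mulVec]
    simpa [dotProduct_smul] using ⟨ih d, hxy a d⟩

lemma span_wordProd_vecMulVec_eq_top [Fintype κ] [Nonempty κ] [DecidableEq κ]
    (hxy : ∀ a b, y a ⬝ᵥ x b ≠ 0)
    {X' : Matrix κ (Fin R) ℂ} (hX : (Matrix.of x)ᵀ * X' = 1)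
    {Y' : Matrix (Fin R) κ ℂ} (hY : Y' * Matrix.of y = 1) {N : ℕ} (hN : 2 ≤ N) :
    Submodule.span ℂ (Set.range fun u : {u : List κ // u.length = N} =>
      wordProd (fun g => vecMulVec (x g) (y g)) u.1) = ⊤ := by
  set V := Submodule.span ℂ (Set.range fun u : {u : List κ // u.length = N} =>
      wordProd (fun g => vecMulVec (x g) (y g)) u.1)
  have hmem : ∀ a b, vecMulVec (x a) (y b) ∈ V := fun a b => by
    obtain ⟨d⟩ := ‹Nonempty κ›
    -- Only the end letters of a word matter up to a nonzero scalar; `w` pads the word to length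
    -- `N`.
    set w := List.replicate (N - 2) d
    have h1 : wordProd (fun g => vecMulVec (x g) (y g)) ([a] ++ w ++ [b]) ∈ V :=
      Submodule.subset_span ⟨⟨[a] ++ w ++ [b], by simp [w]; omega⟩, rfl⟩
    have h2 : wordProd (fun g => vecMulVec (x g) (y g)) ([a] ++ w ++ [b]) =
        (y a ⬝ᵥ (wordProd (fun g => vecMulVec (x g) (y g)) w *ᵥ x b)) •
          vecMulVec (x a) (y b) := by
      rw [← vecMulVec_mul_mul_vecMulVec, wordProd_append, wordProd_append]
      simp [wordProd]
    rw [h2] at h1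
    exact (Submodule.smul_mem_iff _
      (dotProduct_wordProd_vecMulVec_ne_zero x y hxy w a b)).1 h1
  refine eq_top_iff.2 fun B _ => ?_
  have hB : B = ∑ a, ∑ b, (X' * B * Y') a b • vecMulVec (x a) (y b) := by
    have h1 : B = (Matrix.of x)ᵀ * (X' * B * Y') * Matrix.of y := by
      rw [Matrix.mul_assoc X', ← Matrix.mul_assoc, hX, Matrix.one_mul, Matrix.mul_assoc, hY,
        Matrix.mul_one]
    nth_rewrite 1 [h1]
    ext i j
    simp only [mul_apply (M := (Matrix.of x)ᵀ * (X' * B * Y')), mul_apply (M := (Matrix.of x)ᵀ),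
      Finset.sum_mul, Matrix.sum_apply, Matrix.smul_apply, vecMulVec_apply, transpose_apply,
      of_apply, smul_eq_mul]
    rw [Finset.sum_comm]
    refine Finset.sum_congr rfl fun a _ => Finset.sum_congr rfl fun b _ => ?_
    ring
  rw [hB]
  exact V.sum_mem fun a _ => V.sum_mem fun b _ => V.smul_mem _ (hmem a b)

lemma prod_range_vecMulVec (x y : ℕ → Fin R → ℂ) (k : ℕ) :
    ((List.range (k + 1)).map fun r => vecMulVec (x r) (y r)).prod =
      (∏ r ∈ Finset.range k, y r ⬝ᵥ x (r + 1)) • vecMulVec (x 0) (y k) := by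
  induction k with
  | zero => simp
  | succ k ih =>
    rw [List.range_succ, List.map_append, List.prod_append, ih, Finset.prod_range_succ]
    simp only [List.map_cons, List.map_nil, List.prod_cons, List.prod_nil, mul_one,
      smul_mul_assoc, vecMulVec_mul_vecMulVec]
    ext i j
    simp [vecMulVec_apply]
    ring

end RankOne

variable {n : ℕ}

lemma sgn_sum {ι : Type*} (s : Finset ι) (f : ι → ZMod 2) :
    sgn (∑ i ∈ s, f i) = ∏ i ∈ s, sgn (f i) := by
  classical
  induction s using Finset.induction_on with
  | empty => simp
  | insert a s ha ih => rw [Finset.sum_insert ha, Finset.prod_insert ha, sgn_add, ih]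

/-- A tensor of rank one matrices whose overlaps are the signs of the graph state generates the
graph state. -/
lemma mpsState_vecMulVec {R : ℕ} (P : Fin (n + 1) → Fin (n + 1) → ZMod 2)
    (x y : (Fin (n + 1) → ZMod 2) → Fin R → ℂ)
    (hxy : ∀ a b, y a ⬝ᵥ x b = sgn (pairing P b (b + a))) (L : ℕ) [NeZero L] :
    mpsState (fun g => vecMulVec (x g) (y g)) L = graphState P L := by
  obtain ⟨k, rfl⟩ := Nat.exists_eq_succ_of_ne_zero (NeZero.ne L)
  funext g
  set G : ℕ → Fin (n + 1) → ZMod 2 := fun r => cell (r : ZMod (k + 1)) g with hG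
  have h1 : (List.ofFn fun r : Fin (k + 1) => vecMulVec (x (G r)) (y (G r))) =
      (List.range (k + 1)).map fun r => vecMulVec (x (G r)) (y (G r)) :=
    List.ext_getElem (by simp) fun i h1 h2 => by
      rw [List.getElem_ofFn, List.getElem_map, List.getElem_range]
  have hG0 : G (k + 1) = G 0 := by
    simp only [hG]
    rw [ZMod.natCast_self, Nat.cast_zero]
  have h2 : mpsState (fun g => vecMulVec (x g) (y g)) (k + 1) g =
      ∏ r ∈ Finset.range (k + 1), y (G r) ⬝ᵥ x (G (r + 1)) := by
    change ((List.ofFn fun r : Fin (k + 1) => vecMulVec (x (G r)) (y (G r))).prod).trace = _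
    rw [h1, prod_range_vecMulVec (fun r => x (G r)) (fun r => y (G r)), trace_smul,
      trace_vecMulVec, Finset.prod_range_succ, hG0, dotProduct_comm, smul_eq_mul]
  have h3 : graphForm P g =
      ∑ r ∈ Finset.range (k + 1), pairing P (G (r + 1)) (G (r + 1) + G r) := by
    -- The shift by one turns the bonds `(r - 1, r)` of `graphForm` into the bonds `(r, r + 1)` of
    -- the trace.
    rw [graphForm, ← Equiv.sum_comp (Equiv.addRight (1 : ZMod (k + 1))), Finset.sum_range]
    refine Finset.sum_congr rfl fun r _ => ?_
    have hr : ((ZMod.val r : ℕ) : ZMod (k + 1)) = r := ZMod.natCast_zmod_val r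
    change pairing P (cell (r + 1) g) (cell (r + 1) g + cell (r + 1 - 1) g) =
      pairing P (cell (((ZMod.val r + 1 : ℕ)) : ZMod (k + 1)) g)
        (cell (((ZMod.val r + 1 : ℕ)) : ZMod (k + 1)) g + cell ((ZMod.val r : ℕ) : ZMod (k + 1)) g)
    rw [Nat.cast_add, Nat.cast_one, hr, add_sub_cancel_right]
  rw [h2, graphState, h3, sgn_sum]
  exact Finset.prod_congr rfl fun r _ => hxy _ _

/-- One configuration serves all tensors at once, so proportional states give traces proportional
word by word. -/
lemma exists_mpsState_eq_trace_wordProd (L : ℕ) [NeZero L] (u : List (Fin (n + 1) → ZMod 2))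
    (hu : u.length = L) : ∃ g : ZMod L × Fin (n + 1) → ZMod 2,
      ∀ (D : ℕ) (T : MPSTensor n D), mpsState T L g = (wordProd T u).trace := by
  subst hu
  refine ⟨fun p => u.get ⟨p.1.val, ZMod.val_lt _⟩ p.2, fun D T => ?_⟩
  rw [mpsState, wordProd]
  congr 2
  refine List.ext_getElem (by simp) fun i h1 h2 => ?_
  rw [List.getElem_ofFn, List.getElem_map]
  have : ((i : ℕ) : ZMod u.length).val = i := ZMod.val_natCast_of_lt (by simpa using h2)
  simp only [this]
  rfl

theorem rank_eq_one_of_isMinimalGroundStateMPS (P : Fin (n + 1) → Fin (n + 1) → ZMod 2) {D : ℕ}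
    {T : MPSTensor n D} (hT : IsMinimalGroundStateMPS P T) (g : Fin (n + 1) → ZMod 2)
    (hg : T g ≠ 0) : (T g).rank = 1 := by
  refine rank_eq_one_of_le_one ?_ hg
  obtain ⟨⟨L₀, hL₀⟩, hmin⟩ := hT
  obtain ⟨Y, X, hYX, ⟨Y', hY'⟩, ⟨X', hX'⟩⟩ := exists_rank_factorization
    (Matrix.of fun a b : Fin (n + 1) → ZMod 2 => sgn (pairing P b (b + a)))
  set y := fun a i => Y a i with hy
  set x := fun b i => X i b with hx
  have hxy : ∀ a b, y a ⬝ᵥ x b = sgn (pairing P b (b + a)) := fun a b => by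
    have := congrFun (congrFun hYX a) b
    rwa [mul_apply, of_apply] at this
  have hS := mpsState_vecMulVec P x y hxy
  have hDR := hmin _ (fun g => vecMulVec (x g) (y g))
    ⟨0, fun L _ _ => by rw [hS]; exact isGroundState_graphState P L⟩
  -- The bound `L₀ + 1` excludes the empty chain; below it the constant is the junk value `0`.
  have hex : ∀ L, ∃ c : ℂ, L₀ + 1 ≤ L → c ≠ 0 ∧
      ∀ u : List (Fin (n + 1) → ZMod 2), u.length = L → (wordProd T u).trace =
        c * (wordProd (fun g => vecMulVec (x g) (y g)) u).trace := fun L => by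
    by_cases hL : L₀ + 1 ≤ L
    · have : NeZero L := ⟨by omega⟩
      obtain ⟨c, hc, h⟩ := IsGroundState.exists_eq_smul P L (hL₀ L (by omega))
      refine ⟨c, fun _ => ⟨hc, fun u hu => ?_⟩⟩
      obtain ⟨g, hg⟩ := exists_mpsState_eq_trace_wordProd L u hu
      rw [← hg, ← hg, h, hS]
      rfl
    · exact ⟨0, fun h => absurd h hL⟩
  choose c hc using hex
  refine rank_le_one_of_trace_eq (L₀ := L₀ + 1) (c := c) hDR (fun L hL => (hc L hL).1)
    (fun u hu => (hc _ hu).2 u rfl) (fun N hN => span_wordProd_vecMulVec_eq_top x y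
      (fun a b => by rw [hxy]; exact sgn_ne_zero _) (X' := X') hX' (Y' := Y') hY' hN)
    (fun g A => ?_) g
  rw [vecMulVec_mul_mul_vecMulVec, vecMulVec_mul, trace_vecMulVec, dotProduct_mulVec,
    dotProduct_comm]

end Minimal

/-! ### Solutions of the linear equations -/

section LinearEquations

open Matrix

lemma sum_finrank_le_of_iSupIndep {K V ι : Type*} [Field K] [AddCommGroup V] [Module K V]
    [FiniteDimensional K V] [Fintype ι] {E : ι → Submodule K V} (hE : iSupIndep E) :
    ∑ i, Module.finrank K (E i) ≤ Module.finrank K V := by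
  classical
  have h := LinearMap.finrank_le_finrank_of_injective hE.dfinsupp_lsum_injective
  exact (Module.finrank_directSum K fun i => E i).symm.trans_le h

lemma rank_add_le {K m n : Type*} [Field K] [Fintype m] [Fintype n] (A B : Matrix m n K) :
    (A + B).rank ≤ A.rank + B.rank := by
  have h : LinearMap.range (A + B).mulVecLin ≤
      LinearMap.range A.mulVecLin ⊔ LinearMap.range B.mulVecLin := by
    rintro _ ⟨x, rfl⟩
    rw [mulVecLin_add, LinearMap.add_apply]
    exact Submodule.add_mem_sup ⟨x, rfl⟩ ⟨x, rfl⟩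
  exact (Submodule.finrank_mono h).trans (Submodule.finrank_add_le_finrank_add_finrank _ _)

variable {ι : Type*} {D : ℕ} {t : Matrix ι ι (ZMod 2)}
  {p : ι → Prop} {U : ι → GL (Fin D) ℂ}

open Classical in
/-- The block of `t` with rows in `p` and columns outside `p`. -/
noncomputable def offDiagonalBlock (t : Matrix ι ι (ZMod 2)) (p : ι → Prop) :
    Matrix ι ι (ZMod 2) := fun c d => if p c ∧ ¬ p d then t c d else 0

lemma rank_le_two_mul_offDiagonalBlock [Fintype ι] (hsymm : ∀ c d, t c d = t d c)
    (hp : ∀ c d, p c → p d → t c d = 0) (hnp : ∀ c d, ¬ p c → ¬ p d → t c d = 0) :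
    t.rank ≤ 2 * (offDiagonalBlock t p).rank := by
  have h : t = offDiagonalBlock t p + (offDiagonalBlock t p)ᵀ := by
    ext c d
    by_cases hc : p c <;> by_cases hd : p d <;>
      simp [offDiagonalBlock, hc, hd, hp, hnp, hsymm d c]
  calc t.rank = (offDiagonalBlock t p + (offDiagonalBlock t p)ᵀ).rank := by rw [← h]
    _ ≤ (offDiagonalBlock t p).rank + (offDiagonalBlock t p)ᵀ.rank := rank_add_le _ _
    _ = 2 * (offDiagonalBlock t p).rank := by rw [rank_transpose, two_mul]

/-- The range is spanned by the columns of the block: column `d` is realized by `U d` itself, and a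
sum of columns by a product. -/
lemma exists_twist [Fintype ι]
    (hU : ∀ c d, (U c : Matrix (Fin D) (Fin D) ℂ) * U d =
      sgn (t c d) • ((U d : Matrix (Fin D) (Fin D) ℂ) * U c))
    (v : ι → ZMod 2) (hv : v ∈ LinearMap.range (offDiagonalBlock t p).mulVecLin) :
    ∃ V : GL (Fin D) ℂ, ∀ c, p c → (U c : Matrix (Fin D) (Fin D) ℂ) * V =
      sgn (v c) • ((V : Matrix (Fin D) (Fin D) ℂ) * U c) := by
  have key : ∀ z : ZMod 2, z = 0 ∨ z = 1 := by decide
  rw [range_mulVecLin] at hv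
  induction hv using Submodule.span_induction with
  | mem v hv =>
    obtain ⟨d, rfl⟩ := hv
    by_cases hd : p d
    · exact ⟨1, fun c _ => by simp [offDiagonalBlock, hd]⟩
    · exact ⟨U d, fun c hc => by simp [offDiagonalBlock, hd, hc, hU c d]⟩
  | zero => exact ⟨1, fun c _ => by simp⟩
  | add v w _ _ hv hw =>
    obtain ⟨V, hV⟩ := hv
    obtain ⟨W, hW⟩ := hw
    refine ⟨V * W, fun c hc => ?_⟩
    rw [Units.val_mul, ← mul_assoc, hV c hc, smul_mul_assoc, mul_assoc, hW c hc, mul_smul_comm,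
      smul_smul, ← mul_assoc, Pi.add_apply, sgn_add]
  | smul a v _ hv =>
    rcases key a with rfl | rfl
    · exact ⟨1, fun c _ => by simp⟩
    · simpa using hv

/-- If the `U c`, `p c`, commute and act on the rows of `M` by nonzero scalars, then the translates
of the row space of `M` by products of the other `U d` lie in different joint eigenspaces. -/
lemma two_pow_mul_rank_le [Fintype ι] (hp : ∀ c d, p c → p d → t c d = 0)
    (hU : ∀ c d, (U c : Matrix (Fin D) (Fin D) ℂ) * U d =
      sgn (t c d) • ((U d : Matrix (Fin D) (Fin D) ℂ) * U c))
    {M : Matrix (Fin D) (Fin D) ℂ} {σ : ι → ℂ} (hσ : ∀ c, σ c ≠ 0)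
    (hM : ∀ c, p c → M * (U c : Matrix (Fin D) (Fin D) ℂ) = σ c • M) :
    2 ^ (offDiagonalBlock t p).rank * M.rank ≤ D := by
  classical
  let S := LinearMap.range (offDiagonalBlock t p).mulVecLin
  have : Fintype S := Fintype.ofFinite S
  choose V hV using fun v : S => exists_twist hU v.1 v.2
  -- Transposes turn the row spaces and the right action of `U` into ranges and endomorphisms.
  let f : {c // p c} → Module.End ℂ (Fin D → ℂ) := fun c =>
    (U c.1 : Matrix (Fin D) (Fin D) ℂ)ᵀ.mulVecLin
  have hcomm : ∀ c d, Commute (f c) (f d) := fun c d => by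
    have h := hU d.1 c.1
    rw [hp _ _ d.2 c.2, sgn_zero, one_smul] at h
    change (U c.1 : Matrix (Fin D) (Fin D) ℂ)ᵀ.mulVecLin ∘ₗ
      (U d.1 : Matrix (Fin D) (Fin D) ℂ)ᵀ.mulVecLin = _ ∘ₗ _
    rw [← mulVecLin_mul, ← mulVecLin_mul, ← transpose_mul, ← transpose_mul, h]
  let E : S → Submodule ℂ (Fin D → ℂ) := fun v =>
    LinearMap.range ((M * (V v : Matrix (Fin D) (Fin D) ℂ))ᵀ.mulVecLin)
  let χ : S → {c // p c} → ℂ := fun v c => sgn (v.1 c) * σ c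
  -- Vectors in the range of the block vanish outside `p`, so their values on `p` determine them.
  have hχ : Function.Injective χ := fun v w h => by
    ext c
    by_cases hc : p c
    · exact sgn_injective (mul_right_cancel₀ (hσ c) (congrFun h ⟨c, hc⟩))
    · have hz : ∀ x : S, x.1 c = 0 := by
        rintro ⟨_, x, rfl⟩
        simp [mulVec, dotProduct, offDiagonalBlock, hc]
      rw [hz, hz]
  have hE : ∀ v, E v ≤ ⨅ c, (f c).maxGenEigenspace (χ v c) := fun v => by
    refine le_iInf fun c => le_trans ?_ Module.End.eigenspace_le_maxGenEigenspace
    rintro _ ⟨w, rfl⟩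
    rw [Module.End.mem_eigenspace_iff]
    have h1 : (V v : Matrix (Fin D) (Fin D) ℂ) * U c.1 =
        sgn (v.1 c.1) • ((U c.1 : Matrix (Fin D) (Fin D) ℂ) * V v) := by
      rw [hV v c.1 c.2, smul_smul, sgn_mul_self, one_smul]
    have h2 : M * (V v : Matrix (Fin D) (Fin D) ℂ) * U c.1 =
        χ v c • (M * (V v : Matrix (Fin D) (Fin D) ℂ)) := by
      rw [mul_assoc, h1, mul_smul_comm, ← mul_assoc, hM c.1 c.2, smul_mul_assoc, smul_smul]
    change (U c.1 : Matrix (Fin D) (Fin D) ℂ)ᵀ *ᵥ ((M * (V v : Matrix (Fin D) (Fin D) ℂ))ᵀ *ᵥ w) =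
      χ v c • ((M * (V v : Matrix (Fin D) (Fin D) ℂ))ᵀ *ᵥ w)
    rw [mulVec_mulVec, ← transpose_mul, h2, transpose_smul, smul_mulVec]
  have hind : iSupIndep E :=
    ((Module.End.independent_iInf_maxGenEigenspace_of_forall_mapsTo f fun c d φ =>
      Module.End.mapsTo_maxGenEigenspace_of_comm (hcomm d c) φ).comp hχ).mono hE
  have hrank : ∀ v, Module.finrank ℂ (E v) = M.rank := fun v => by
    change (M * (V v : Matrix (Fin D) (Fin D) ℂ))ᵀ.rank = M.rank
    rw [rank_transpose, rank_mul_eq_left_of_isUnit_det]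
    exact (Matrix.isUnit_iff_isUnit_det _).1 (V v).isUnit
  have hcard : Fintype.card S = 2 ^ (offDiagonalBlock t p).rank := by
    rw [Module.card_eq_pow_finrank (K := ZMod 2), ZMod.card]
    rfl
  have := sum_finrank_le_of_iSupIndep hind
  simpa [hrank, hcard] using this

/-! ### Cuts of the stabilizers and their commutation. -/

variable {n : ℕ} (P : Fin (n + 1) → Fin (n + 1) → ZMod 2)

lemma localFactor_one_eq_weyl {κ M : Type*} [AddCommGroup M] [Module ℂ M]
    (X : Fin (n + 1) → Module.End ℂ ((κ → ZMod 2) → M)) (e : Fin (n + 1) → κ)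
    {α : Fin (n + 1)} (hα : α = 0 ∨ α ≠ Fin.last n) :
    localFactor P X (fun i => pauliZ (e i)) α 1 = weyl ((aboveForm P α).comp (readout e)) 0 := by
  rw [← prod_above_eq_weyl P _ _ fun l => pauliZ_eq_weyl_readout e l]
  rcases hα with rfl | h
  · simp [localFactor]
  · simp [localFactor, h]

/-- The cuts whose left part flips a spin. -/
def Cut.Flips (c : Cut n) : Prop := c.1 ≠ 0 ∧ c.pos + 1 = cellRange c.1

/-- For `α = 0` the flip sits in the last factor, beyond the only cut; for middle `α` it sits in the
second of three factors. -/
lemma Cut.pos_eq_one_of_not_flips {c : Cut n} (hc : ¬ c.Flips) :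
    c.pos = 1 ∧ (c.1 = 0 ∨ c.1 ≠ Fin.last n) := by
  obtain ⟨α, τ, hτ⟩ := c
  have hτ' : τ < (if α = 0 ∨ α = Fin.last n then 2 else 3) - 1 := hτ
  simp only [Cut.Flips, Cut.pos, cellRange] at hc ⊢
  grind

lemma leftPart_of_not_flips {c : Cut n} (hc : ¬ c.Flips) :
    leftPart P (0 - (c.pos : ℤ) + 1) c.1 c.pos = weyl ((aboveForm P c.1).comp (cell 0)) 0 := by
  obtain ⟨h1, h2⟩ := c.pos_eq_one_of_not_flips hc
  rw [h1, leftPart]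
  simp only [List.range_one, List.map_cons, List.map_nil, List.prod_cons, List.prod_nil, mul_one]
  rw [localFactor_one_eq_weyl P _ (fun i => ((0 - ((1 : ℕ) : ℤ) + 1 + ((0 : ℕ) : ℤ)), i)) h2]
  simp

/-- Aligned at the common bond, all these operators flip a spin of cell `0`. One formula covers both
cell ranges since `aboveForm` vanishes at the last spin. -/
lemma leftPart_of_flips {c : Cut n} (hc : c.Flips) :
    leftPart P (0 - (c.pos : ℤ) + 1) c.1 c.pos =
      weyl ((aboveForm P c.1).comp (cell (-1) + cell 0) + (belowForm P c.1).comp (cell 0))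
        (Pi.single (0, c.1) 1) := by
  obtain ⟨α, τ⟩ := c
  obtain ⟨h0, hpos⟩ := hc
  simp only at h0 hpos ⊢
  generalize Cut.pos ⟨α, τ⟩ = k at *
  have above : ∀ c : ℤ, ((List.finRange (n + 1)).map fun l => if α < l then
      (pauliZ (c, l) : Module.End ℂ (ChainState ℤ n)) ^ (P α l).val else 1).prod =
      weyl ((aboveForm P α).comp (cell c)) 0 := fun c =>
    prod_above_eq_weyl P _ _ fun l => pauliZ_eq_weyl_readout (Prod.mk c) l
  have below : ∀ c : ℤ, ((List.finRange (n + 1)).map fun l => if l < α then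
      (pauliZ (c, l) : Module.End ℂ (ChainState ℤ n)) ^ (P l α).val else 1).prod =
      weyl ((belowForm P α).comp (cell c)) 0 := fun c =>
    prod_below_eq_weyl P _ _ fun l => pauliZ_eq_weyl_readout (Prod.mk c) l
  have hb : (belowForm P α).comp (cell 0)
      (Pi.single (0, α) 1 : ℤ × Fin (n + 1) → ZMod 2) = 0 := by
    simp [belowForm_cell_single]
  by_cases hl : α = Fin.last n
  · obtain rfl : k = 1 := by simpa [cellRange, hl] using hpos
    have : leftPart P (0 - ((1 : ℕ) : ℤ) + 1) α 1 =
        pauliX (0, α) * weyl ((belowForm P α).comp (cell 0)) 0 := by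
      rw [← below]
      simp [leftPart, localFactor, h0, ← hl]
    rw [this, pauliX_eq_weyl, weyl_mul_weyl _ _ _ _ hb, add_zero]
    congr 2
    rw [hl, aboveForm_last]
    rfl
  · obtain rfl : k = 2 := by simpa [cellRange, h0, hl] using hpos
    have : leftPart P (0 - ((2 : ℕ) : ℤ) + 1) α 2 =
        weyl ((aboveForm P α).comp (cell (-1))) 0 * (weyl ((aboveForm P α).comp (cell 0)) 0 *
          pauliX (0, α) * weyl ((belowForm P α).comp (cell 0)) 0) := by
      rw [← below, ← above, ← above]
      simp [leftPart, localFactor, h0, hl, List.range_succ]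
    rw [this, pauliX_eq_weyl, weyl_mul_weyl _ _ _ _ rfl, zero_add, weyl_mul_weyl _ _ _ _ hb,
      weyl_mul_weyl _ _ _ _ (map_zero _), add_zero, zero_add, ← add_assoc]
    congr 2
    · ext g
      simp
    · simp

lemma commutationMatrix_of_not_flips {c d : Cut n} (hc : ¬ c.Flips) (hd : ¬ d.Flips) :
    commutationMatrix P c d = 0 := by
  refine if_pos ?_
  rw [leftPart_of_not_flips P hc, leftPart_of_not_flips P hd]
  exact weyl_commute (by simp)

/-- Each flip changes the other's form by the entry of `P` at the ordered pair of the two spins (or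
`0` if they coincide), which is symmetric. -/
lemma commutationMatrix_of_flips {c d : Cut n} (hc : c.Flips) (hd : d.Flips) :
    commutationMatrix P c d = 0 := by
  refine if_pos ?_
  rw [leftPart_of_flips P hc, leftPart_of_flips P hd]
  refine weyl_commute ?_
  simp only [AddMonoidHom.add_apply, AddMonoidHom.comp_apply, cell_single,
    if_neg (show (-1 : ℤ) ≠ 0 by decide), if_true, zero_add, aboveForm_single,
    belowForm_single]
  exact add_comm _ _

lemma commutationMatrix_symm (c d : Cut n) :
    commutationMatrix P c d = commutationMatrix P d c := by
  classical
  exact if_congr Commute.symm_iff rfl rfl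

theorem rank_eq_one_of_solvesLinearEquations {U : Cut n → GL (Fin (irrepDim P)) ℂ}
    {T : MPSTensor n (irrepDim P)} (hU : IsVirtualAlgebra P U) (hT : SolvesLinearEquations P U T)
    (g : Fin (n + 1) → ZMod 2) (hg : T g ≠ 0) : (T g).rank = 1 := by
  refine rank_eq_one_of_le_one ?_ hg
  have hle := two_pow_mul_rank_le (t := commutationMatrix P) (p := fun c : Cut n => ¬ c.Flips)
    (U := U) (M := T g) (σ := fun c => sgn (aboveForm P c.1 g))
    (fun c d hc hd => commutationMatrix_of_not_flips P hc hd) hU (fun c => sgn_ne_zero _)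
    (fun c hc => by
      obtain ⟨h1, h2⟩ := c.pos_eq_one_of_not_flips hc
      rw [← hT.first c h1 g]
      change localFactor P (R := Module.End ℂ (MPSTensor n (irrepDim P))) pauliX
        (fun i => pauliZ (id i)) c.1 1 T g = _
      rw [localFactor_one_eq_weyl P _ id h2, weyl_apply, add_zero]
      rfl)
  have hrank := rank_le_two_mul_offDiagonalBlock (t := commutationMatrix P)
    (p := fun c : Cut n => ¬ c.Flips) (commutationMatrix_symm P)
    (fun c d hc hd => commutationMatrix_of_not_flips P hc hd)
    (fun c d hc hd => commutationMatrix_of_flips P (not_not.1 hc) (not_not.1 hd))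
  -- The floor in `rank / 2` is harmless, since `rank t ≤ 2 rank B` already gives `rank t / 2 ≤ rank
  -- B`.
  have hdim : irrepDim P ≤
      2 ^ (offDiagonalBlock (commutationMatrix P) fun c : Cut n => ¬ c.Flips).rank :=
    Nat.pow_le_pow_right (by norm_num) (by omega)
  by_contra! h
  have hpos : 0 < 2 ^ (offDiagonalBlock (commutationMatrix P) fun c : Cut n => ¬ c.Flips).rank := by
    positivity
  nlinarith

end LinearEquations

end CocycleMPS

theorem theorem3 (n : ℕ) (P : Fin (n + 1) → Fin (n + 1) → ZMod 2) :
    (∀ (D : ℕ) (T : CocycleMPS.MPSTensor n D), CocycleMPS.IsMinimalGroundStateMPS P T →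
      ∀ g : Fin (n + 1) → ZMod 2, T g ≠ 0 → (T g).rank = 1) ∧
    (∀ (U : CocycleMPS.Cut n → GL (Fin (CocycleMPS.irrepDim P)) ℂ)
      (T : CocycleMPS.MPSTensor n (CocycleMPS.irrepDim P)),
      CocycleMPS.IsVirtualAlgebra P U → CocycleMPS.SolvesLinearEquations P U T →
      ∀ g : Fin (n + 1) → ZMod 2, T g ≠ 0 → (T g).rank = 1) := by
  exact ⟨fun _ _ hT => CocycleMPS.rank_eq_one_of_isMinimalGroundStateMPS P hT,
    fun _ _ hU hT => CocycleMPS.rank_eq_one_of_solvesLinearEquations P hU hT⟩
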